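/- Let $n\ge 1$ and $m\ge 1$ be integers, put $q=2^n$, and let $$T(x)=\sum_{i=0}^{n-1}x^{2^i-1},\qquad C(x)=x\,T(x)^{q+1}$$ be polynomials in $\mathbb F_2[x]$ (so $C$ is a Müller–Cohen–Matthews polynomial). Then $C(x)$ induces a permutation on the finite field $\mathbb F_{2^m}$, that is, the map $\mathbb F_{2^m}\to\mathbb F_{2^m}$, $x\mapsto C(x)$, is bijective, if and only if $\gcd(n,2m)=1$. -/

import Mathlib

open Polynomial

/-- The polynomial `T(x) = ∑_{i=0}^{n-1} x^(2^i - 1)` (here `2^i ≥ 1`, so the subtraction is exact),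
with coefficients in `R`. -/
noncomputable def polyT (R : Type*) [CommRing R] (n : ℕ) : R[X] :=
  ∑ i ∈ Finset.range n, X ^ (2 ^ i - 1)

/-- The Müller–Cohen–Matthews polynomial `C(x) = x * T(x)^(q+1)`, where `q = 2^n`. -/
noncomputable def polyC (R : Type*) [CommRing R] (n : ℕ) : R[X] :=
  X * polyT R n ^ (2 ^ n + 1)

/-- `P` induces a permutation on `R`: the map `x ↦ P(x)` is a bijection of `R` onto itself. -/
def InducesPermutation {R : Type*} [CommRing R] (P : R[X]) : Prop :=
  Function.Bijective (fun x : R => P.eval x)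

/-! Let S(x) = x T(x), an additive map with S² + S = x^q + x and C(x) x^q = S(x)^(q+1). So C and S
have the same zeros. If gcd(n, 2m) ≠ 1, S has a nonzero root and C is not injective. Otherwise S(1)
= 1 and x^q fixes only 0 and 1, so S has trivial kernel; at a common nonzero value 1/b of C,
`eq_of_map_eq_mul_map` turns x^q = b S(x)^(q+1) into equations linear in x/S(x) and S(x), and two
distinct solutions lead to 1 = 0. -/

theorem eval_polyT_mul {K : Type*} [CommRing K] (n : ℕ) (x : K) :
    x * (polyT K n).eval x = ∑ i ∈ Finset.range n, x ^ 2 ^ i := by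
  rw [polyT, eval_finsetSum, Finset.mul_sum]
  refine Finset.sum_congr rfl fun i _ => ?_
  rw [eval_pow, eval_X, ← pow_succ', Nat.sub_add_cancel Nat.one_le_two_pow]

theorem eval_polyC {K : Type*} [CommRing K] (n : ℕ) (x : K) :
    (polyC K n).eval x = x * (polyT K n).eval x ^ (2 ^ n + 1) := by
  simp [polyC]

/-- The additive map `x ↦ ∑_{i<n} x^(2^i)` in characteristic two. -/
def absTraceSum (K : Type*) [CommRing K] [CharP K 2] (n : ℕ) : K →+ K :=
  ∑ i ∈ Finset.range n, (iterateFrobenius K 2 i : K →+ K)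

section AbsTraceSum

variable {K : Type*} [CommRing K] [CharP K 2]

theorem absTraceSum_apply (n : ℕ) (x : K) :
    absTraceSum K n x = ∑ i ∈ Finset.range n, x ^ 2 ^ i := by
  simp [absTraceSum, AddMonoidHom.finsetSum_apply, iterateFrobenius_def]

theorem absTraceSum_sq (n : ℕ) (x : K) : absTraceSum K n (x ^ 2) = absTraceSum K n x ^ 2 := by
  simp only [absTraceSum_apply, sum_pow_char 2, ← pow_mul, mul_comm]

theorem absTraceSum_sq_add (n : ℕ) (x : K) :
    absTraceSum K n x ^ 2 + absTraceSum K n x = x ^ 2 ^ n + x := by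
  rw [absTraceSum_apply, sum_pow_char 2]
  induction n with
  | zero => simp [CharTwo.add_self_eq_zero]
  | succ n ih =>
    rw [Finset.sum_range_succ, Finset.sum_range_succ]
    have h : (x ^ 2 ^ n) ^ 2 = x ^ 2 ^ (n + 1) := by rw [← pow_mul, pow_succ]
    linear_combination ih + h + CharTwo.add_self_eq_zero (x ^ 2 ^ n)

theorem absTraceSum_one (n : ℕ) : absTraceSum K n 1 = n := by
  simp [absTraceSum_apply]

end AbsTraceSum

/-- Injectivity of `x ↦ S(x)^(q+1) / x^q` away from the zeros of `S`, in terms of the formal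
properties of the `q`-Frobenius `φ` and the partial trace `S`. -/
theorem eq_of_map_eq_mul_map {K : Type*} [Field K] [CharP K 2] (φ : K →+* K) (S : K →+ K)
    (hsq : ∀ t, S (t ^ 2) = S t ^ 2) (hφ : ∀ t, S t ^ 2 + S t = φ t + t) (hone : S 1 = 1)
    (hfix : ∀ t, φ t = t → t = 0 ∨ t = 1) (hroot : ∀ t : K, ∃ r, r ^ 2 = t)
    {b x y : K} (hSx : S x ≠ 0) (hSy : S y ≠ 0)
    (hx : φ x = b * (S x * φ (S x))) (hy : φ y = b * (S y * φ (S y))) : x = y := by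
  have two : (2 : K) = 0 := CharTwo.two_eq_zero
  have hsum : ∀ a c : K, a + c = 0 → a = c := fun a c h => CharTwo.add_eq_zero.1 h
  have hSxx := hφ x
  have hSyy := hφ y
  have hSadd := S.map_add x y
  obtain ⟨s, hs⟩ : ∃ s, s = S x := ⟨_, rfl⟩
  obtain ⟨s', hs'⟩ : ∃ s', s' = S y := ⟨_, rfl⟩
  rw [← hs] at hSx hx hSxx hSadd
  rw [← hs'] at hSy hy hSyy hSadd
  have hφs : φ s ≠ 0 := by simpa using hSx
  have hφs' : φ s' ≠ 0 := by simpa using hSy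
  by_cases hz : s + s' = 0
  · have h := hsum _ _ hz
    apply φ.injective
    rw [hx, hy, h]
  exfalso
  obtain ⟨z, hzd⟩ : ∃ z, z = s + s' := ⟨_, rfl⟩
  rw [← hzd] at hz hSadd
  obtain rfl : s' = s + z := by linear_combination -hzd - s * two
  -- With u = x/s the two relations become φ u = b s and b φ s + u = s + 1. Subtracting those for y
  -- leaves a homogeneous system for (w, z).
  obtain ⟨u, hu⟩ : ∃ u, x = u * s := ⟨x / s, by field_simp⟩
  obtain ⟨v, hv⟩ : ∃ v, y = v * (s + z) := ⟨y / (s + z), by field_simp⟩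
  obtain ⟨w, rfl⟩ : ∃ w, v = u + w := ⟨v - u, by ring⟩
  have hφu : φ u = b * s := by
    apply mul_right_cancel₀ hφs
    rw [← map_mul, ← hu, hx]; ring
  have hφv : φ u + φ w = b * (s + z) := by
    apply mul_right_cancel₀ hφs'
    rw [← map_add, ← map_mul, ← hv, hy]; ring
  have hφw : φ w = b * z := by linear_combination hφv - hφu
  have hus : b * φ s + u = s + 1 := by
    apply mul_left_cancel₀ hSx
    linear_combination -hSxx - hx - hu
  have hvs : b * φ (s + z) + (u + w) = s + z + 1 := by
    apply mul_left_cancel₀ hSy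
    linear_combination -hSyy - hy - hv
  have hw : b * φ z + w = z := by
    rw [map_add] at hvs
    linear_combination hvs - hus
  have hb : b ≠ 0 := by
    rintro rfl
    rw [zero_mul] at hx
    rw [(map_eq_zero φ).1 hx, map_zero] at hs
    exact hSx hs
  have hw0 : w ≠ 0 := by
    rintro rfl
    rw [map_zero] at hφw
    exact mul_ne_zero hb hz hφw.symm
  obtain ⟨p, rfl⟩ : ∃ p, s = p * z := ⟨s / z, by field_simp⟩
  obtain ⟨r, rfl⟩ : ∃ r, u = r * w := ⟨u / w, by field_simp⟩
  have hφr : φ r = p := by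
    apply mul_right_cancel₀ (mul_ne_zero hb hz)
    rw [map_mul, hφw] at hφu
    linear_combination hφu
  rw [map_mul] at hus
  have hk : φ (w * z * (p + r)) + w * z * (p + r) = z := by
    simp only [map_mul, map_add, hφw, hφr]
    linear_combination z * hus + p * z * hw + p * z ^ 2 * two
  -- φ(wz) = b z φ(z) = z² + wz, so the square root γ solves t + φ t = z, as does wz(p + r). Their
  -- difference η is fixed by φ.
  obtain ⟨γ, hγ⟩ := hroot (w * z)
  have hγz : γ + φ γ = z := by
    apply hsum _ _
    have : (γ + φ γ + z) ^ 2 = 0 := by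
      have h := congrArg φ hγ
      rw [map_pow, map_mul, hφw] at h
      linear_combination hγ + h + z * hw + (γ * φ γ + z * γ + z * φ γ + z ^ 2) * two
    exact pow_eq_zero_iff two_ne_zero |>.1 this
  obtain ⟨η, hη⟩ : ∃ η, w * z * (p + r) = γ + η := ⟨w * z * (p + r) - γ, by ring⟩
  rw [hη, map_add] at hk
  have hηφ : φ η = η := by
    apply hsum _ _
    linear_combination hk - hγz
  have hxy : x + y = (γ + η) + γ ^ 2 := by
    rw [hu, hv, hγ, ← hη]
    linear_combination r * w * (p * z) * two
  -- S(x + y) = z = S(γ + γ²), hence S η = 0, which excludes η = 1.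
  have hη0 : η = 0 := by
    have h := hφ γ
    rw [hxy, map_add, map_add, hsq] at hSadd
    have hSη : S η = 0 := by linear_combination hSadd - h - hγz
    refine (hfix η hηφ).resolve_right ?_
    rintro rfl
    exact one_ne_zero (hone.symm.trans hSη)
  subst hη0
  have hγ0 : γ ≠ 0 := by
    rintro rfl
    exact mul_ne_zero hw0 hz (by rw [← hγ]; ring)
  have hδ : γ * (p + r) = 1 := by
    apply mul_left_cancel₀ hγ0
    linear_combination hη + (p + r) * hγ
  -- x = γp · γr with γr = γp + 1. So s = S x = φ(γp) + γp, while s = pz = p(γ + φ γ); this forces φ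
  -- γ (φ p + p) = 0, yet φ applied to `hδ` makes it 1.
  have hxp : x = (γ * p) ^ 2 + γ * p := by
    rw [hu]
    linear_combination -p * r * hγ + γ * p * hδ - γ ^ 2 * p ^ 2 * two
  have h := hφ (γ * p)
  rw [hxp, map_add, hsq, h, ← hγz, map_mul] at hs
  have hδφ := congrArg φ hδ
  rw [map_mul, map_add, hφr, map_one] at hδφ
  exact one_ne_zero (α := K) (by linear_combination -hδφ - hs + φ γ * p * two)

/-- An element of prime order l dividing 2^gcd(n, m) - 1 works. -/
theorem exists_pow_two_pow_eq_self {K : Type*} [Field K] [Finite K] {n m : ℕ}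
    (hK : Nat.card K = 2 ^ m) (h : Nat.gcd n m ≠ 1) (hn : n ≠ 0) :
    ∃ x : K, x ^ 2 ^ n = x ∧ x ≠ 0 ∧ x ≠ 1 := by
  have hd : 2 ≤ Nat.gcd n m := by
    have := Nat.gcd_pos_of_pos_left m (Nat.pos_of_ne_zero hn)
    omega
  have hd' : 2 ^ 2 ≤ 2 ^ Nat.gcd n m := Nat.pow_le_pow_right two_pos hd
  obtain ⟨l, hl, hdvd⟩ := Nat.exists_prime_and_dvd (n := 2 ^ Nat.gcd n m - 1) (by omega)
  have hcard : l ∣ Nat.card Kˣ := by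
    rw [Nat.card_units, hK]
    exact hdvd.trans (Nat.pow_sub_one_dvd_pow_sub_one 2 (Nat.gcd_dvd_right n m))
  have : Fact l.Prime := ⟨hl⟩
  obtain ⟨x, hx⟩ := exists_prime_orderOf_dvd_card' l hcard
  refine ⟨x, ?_, x.ne_zero, ?_⟩
  · have h1 : x ^ (2 ^ n - 1) = 1 := orderOf_dvd_iff_pow_eq_one.1 <| hx ▸
      hdvd.trans (Nat.pow_sub_one_dvd_pow_sub_one 2 (Nat.gcd_dvd_left n m))
    have h2 : x ^ 2 ^ n = x := by
      rw [← Nat.sub_add_cancel (Nat.one_le_two_pow (n := n)), pow_succ, h1, one_mul]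
    exact_mod_cast congrArg Units.val h2
  · intro h1
    rw [Units.val_eq_one.1 h1, orderOf_one] at hx
    exact hl.one_lt.ne hx

theorem eq_zero_or_one_of_pow_two_pow_eq_self {K : Type*} [Field K] [Finite K] [CharP K 2]
    {n m : ℕ} (hK : Nat.card K = 2 ^ m) (h : Nat.gcd n m = 1) {x : K} (hx : x ^ 2 ^ n = x) :
    x = 0 ∨ x = 1 := by
  have : Fintype K := Fintype.ofFinite K
  have h1 : Function.IsPeriodicPt (frobenius K 2) n x := by
    rw [Function.IsPeriodicPt, Function.IsFixedPt, ← coe_iterateFrobenius, iterateFrobenius_def, hx]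
  have h2 : Function.IsPeriodicPt (frobenius K 2) m x := by
    rw [Function.IsPeriodicPt, Function.IsFixedPt, ← coe_iterateFrobenius, iterateFrobenius_def,
      ← hK, Nat.card_eq_fintype_card, FiniteField.pow_card]
  have h3 := h1.gcd h2
  rw [h] at h3
  have h4 : x ^ 2 = x := by simpa [Function.IsPeriodicPt, Function.IsFixedPt, frobenius_def] using h3
  exact IsIdempotentElem.iff_eq_zero_or_one.1 (by rw [IsIdempotentElem, ← pow_two, h4])

theorem eval_polyC_mul_pow {K : Type*} [CommRing K] [CharP K 2] (n : ℕ) (x : K) :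
    (polyC K n).eval x * x ^ 2 ^ n = absTraceSum K n x ^ (2 ^ n + 1) := by
  rw [eval_polyC, absTraceSum_apply, ← eval_polyT_mul]
  ring

theorem eval_polyC_eq_zero_iff {K : Type*} [Field K] [CharP K 2] (n : ℕ) (x : K) :
    (polyC K n).eval x = 0 ↔ absTraceSum K n x = 0 := by
  rw [eval_polyC, absTraceSum_apply, ← eval_polyT_mul]
  simp

theorem polyC_injective {K : Type*} [Field K] [Finite K] [CharP K 2] {n m : ℕ}
    (hK : Nat.card K = 2 ^ m) (hodd : Odd n) (h : Nat.gcd n m = 1) :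
    Function.Injective fun x : K => (polyC K n).eval x := by
  have hone : absTraceSum K n 1 = 1 := by
    rw [absTraceSum_one, CharTwo.natCast_eq_ite, if_neg (Nat.not_even_iff_odd.2 hodd)]
  have hker : ∀ x : K, absTraceSum K n x = 0 → x = 0 := by
    intro x hx
    have h1 := absTraceSum_sq_add n x
    rw [hx, zero_pow two_ne_zero, add_zero] at h1
    refine (eq_zero_or_one_of_pow_two_pow_eq_self hK h
      (CharTwo.add_eq_zero.1 h1.symm)).resolve_right ?_
    rintro rfl
    exact one_ne_zero (hone.symm.trans hx)
  intro x y hxy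
  dsimp only at hxy
  by_cases ha : (polyC K n).eval x = 0
  · rw [hker x ((eval_polyC_eq_zero_iff n x).1 ha),
      hker y ((eval_polyC_eq_zero_iff n y).1 (hxy ▸ ha))]
  have key : ∀ t : K, (polyC K n).eval t = (polyC K n).eval x →
      iterateFrobenius K 2 n t = ((polyC K n).eval x)⁻¹ *
        (absTraceSum K n t * iterateFrobenius K 2 n (absTraceSum K n t)) := by
    intro t ht
    rw [eq_inv_mul_iff_mul_eq₀ ha, iterateFrobenius_def, iterateFrobenius_def, ← ht,
      eval_polyC_mul_pow, pow_succ']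
  refine eq_of_map_eq_mul_map (iterateFrobenius K 2 n) (absTraceSum K n) (absTraceSum_sq n)
    (fun t => ?_) hone (fun t ht => ?_) (fun t => ?_) (fun h0 => ?_) (fun h0 => ?_)
    (key x rfl) (key y hxy.symm)
  · rw [absTraceSum_sq_add, iterateFrobenius_def]
  · exact eq_zero_or_one_of_pow_two_pow_eq_self hK h (by rwa [iterateFrobenius_def] at ht)
  · exact surjective_frobenius K 2 t
  · exact ha ((eval_polyC_eq_zero_iff n x).2 h0)
  · exact ha (hxy.trans ((eval_polyC_eq_zero_iff n y).2 h0))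

theorem exists_ne_zero_absTraceSum_eq_zero {K : Type*} [Field K] [Finite K] [CharP K 2] {n m : ℕ}
    (hK : Nat.card K = 2 ^ m) (hn : n ≠ 0) (h : Even n ∨ Nat.gcd n m ≠ 1) :
    ∃ x : K, x ≠ 0 ∧ absTraceSum K n x = 0 := by
  rcases n.even_or_odd with he | ho
  · exact ⟨1, one_ne_zero, by rw [absTraceSum_one, CharTwo.natCast_eq_ite, if_pos he]⟩
  obtain ⟨x, hx, hx0, hx1⟩ := exists_pow_two_pow_eq_self hK
    (h.resolve_left (Nat.not_even_iff_odd.2 ho)) hn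
  have hS := absTraceSum_sq_add n x
  rw [hx, CharTwo.add_self_eq_zero] at hS
  -- S x lies in {0, 1} and S 1 = 1, so x or x + 1 is a root.
  have hidem : absTraceSum K n x = 0 ∨ absTraceSum K n x = 1 :=
    IsIdempotentElem.iff_eq_zero_or_one.1
      (by rw [IsIdempotentElem, ← pow_two]; exact CharTwo.add_eq_zero.1 hS)
  rcases hidem with h0 | h1
  · exact ⟨x, hx0, h0⟩
  · refine ⟨x + 1, fun h => hx1 (CharTwo.add_eq_zero.1 h), ?_⟩
    rw [map_add, h1, absTraceSum_one, CharTwo.natCast_eq_ite, if_neg (Nat.not_even_iff_odd.2 ho),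
      CharTwo.add_self_eq_zero]

theorem mainTheorem6 (n m : ℕ) (hn : 1 ≤ n)
    (K : Type*) [Field K] (hK : Nat.card K = 2 ^ m) :
    InducesPermutation (polyC K n) ↔ Nat.gcd n (2 * m) = 1 := by
  have : Finite K := Nat.finite_of_card_ne_zero (by rw [hK]; positivity)
  have : Fintype K := Fintype.ofFinite K
  have : CharP K 2 := by
    have : Fact (Nat.Prime 2) := ⟨Nat.prime_two⟩
    exact charP_of_card_eq_prime_pow (f := m) (by rw [← Nat.card_eq_fintype_card, hK])
  have hgcd : Nat.gcd n (2 * m) = 1 ↔ Odd n ∧ Nat.gcd n m = 1 := by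
    rw [← Nat.coprime_iff_gcd_eq_one, Nat.coprime_mul_iff_right, Nat.coprime_two_right,
      Nat.coprime_iff_gcd_eq_one]
  rw [hgcd]
  constructor
  · intro hP
    by_contra hcon
    obtain ⟨x, hx0, hx⟩ := exists_ne_zero_absTraceSum_eq_zero hK (Nat.one_le_iff_ne_zero.1 hn)
      (by rwa [not_and_or, Nat.not_odd_iff_even] at hcon)
    refine hx0 (hP.injective ?_)
    exact ((eval_polyC_eq_zero_iff n x).2 hx).trans
      ((eval_polyC_eq_zero_iff n 0).2 (map_zero _)).symm
  · rintro ⟨ho, hc⟩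
    exact Finite.injective_iff_bijective.1 (polyC_injective hK ho hc)
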